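/- For integers $0\le k\le n$, let $G(n,k,1)$ be the graph whose vertices are the $k$-element subsets of $\{1,\dots,n\}$, with two distinct subsets $A,B$ adjacent if and only if $|A\cap B|=1$. For a finite graph $G=(V,E)$ with $V\neq\emptyset$, let \[\vartheta(G)=\min_A \mathrm{lev}(A),\] where $A$ ranges over the real symmetric $V\times V$ matrices with $a_{ij}=1$ whenever $\{i,j\}\notin E$ (including $i=j$), and $\mathrm{lev}(A)$ is the largest eigenvalue of $A$ (the Lovász number); and let $\vartheta'(G)$ be the minimum of $\mathrm{lev}(A)$ over the real symmetric $V\times V$ matrices with $a_{ij}\ge 1$ whenever $\{i,j\}\notin E$ (including $i=j$) (Schrijver's variant). Theorem. Let $n$ and $k$ be integers with $k\ge 3$ and $3k-3\le n<k^2-k+1$. Then, for $G=G(n,k,1)$, both minima are attained, \[\vartheta(G(n,k,1))>\binom{n-2}{k-2},\qquad \vartheta(G(n,k,1))=\frac{k^2-n}{n(k-1)}\binom{n}{k},\] and $\vartheta'(G(n,k,1))<\vartheta(G(n,k,1))$. Moreover, these graphs form an infinite family of graphs with $\vartheta'<\vartheta$, even up to isomorphism: for every $N$ there are $n,k$ in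 the above range for which $G(n,k,1)$ has more than $N$ vertices and $\vartheta'(G(n,k,1))<\vartheta(G(n,k,1))$. -/

import Mathlib

/-- The graph `G(n, k, ℓ)`: its vertices are the `k`-element subsets of an `n`-element set, and two
distinct such subsets are adjacent when their intersection has exactly `ℓ` elements. -/
def intersectionGraph (n k ℓ : ℕ) : SimpleGraph {A : Finset (Fin n) // A.card = k} where
  Adj A B := A ≠ B ∧ (A.1 ∩ B.1).card = ℓ
  symm := ⟨fun A B h => ⟨h.1.symm, by rw [Finset.inter_comm]; exact h.2⟩⟩
  loopless := ⟨fun _ h => h.1 rfl⟩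

/-- `x` is the largest eigenvalue of the square real matrix `A`
(over a field, the spectrum of a matrix is its set of eigenvalues). -/
def IsLargestEigenvalue {V : Type*} [Fintype V] [DecidableEq V] (A : Matrix V V ℝ) (x : ℝ) : Prop :=
  IsGreatest (spectrum ℝ A) x

/-- The largest eigenvalues of the real symmetric matrices `A`, indexed by the vertices of `G`, with
`A i j = 1` whenever `{i, j}` is not an edge (in particular on the diagonal). -/
def lovaszValues {V : Type*} [Fintype V] [DecidableEq V] (G : SimpleGraph V) : Set ℝ :=
  {x | ∃ A : Matrix V V ℝ, A.IsSymm ∧ (∀ i j, ¬ G.Adj i j → A i j = 1) ∧ IsLargestEigenvalue A x}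

/-- The Lovász number `ϑ(G)`. -/
noncomputable def lovaszNumber {V : Type*} [Fintype V] [DecidableEq V] (G : SimpleGraph V) : ℝ :=
  sInf (lovaszValues G)

/-- The largest eigenvalues of the real symmetric matrices `A`, indexed by the vertices of `G`, with
`A i j ≥ 1` whenever `{i, j}` is not an edge (in particular on the diagonal). -/
def schrijverValues {V : Type*} [Fintype V] [DecidableEq V] (G : SimpleGraph V) : Set ℝ :=
  {x | ∃ A : Matrix V V ℝ, A.IsSymm ∧ (∀ i j, ¬ G.Adj i j → 1 ≤ A i j) ∧ IsLargestEigenvalue A x}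

/-- Schrijver's variant `ϑ'(G)` of the Lovász number, also called the Delsarte number. -/
noncomputable def schrijverNumber {V : Type*} [Fintype V] [DecidableEq V] (G : SimpleGraph V) : ℝ :=
  sInf (schrijverValues G)

/-!
Both bounds on `ϑ(G(n, k, 1))` come from the Johnson scheme, that is, from matrices whose entry at
`(A, B)` depends only on `|A ∩ B|`.

Lower bound (`le_of_mem_lovaszValues`): the matrix with entries `|A ∩ B| - 1` is positive semidefinite
because `n ≤ k²`, and it vanishes on the edges. Pairing it with a feasible matrix gives the bound,
by Cauchy–Schwarz.

Upper bound: a feasible matrix `J - t A₁`, with `A₁` the adjacency matrix, has to have no eigenvalue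
above the claimed value. Its eigenvalues are found without decomposing the scheme. If `v` is an
eigenvector of the kernel `f |A ∩ B|`, then `T ↦ v (T ∪ {a}) - v (T ∪ {b})` satisfies the eigenvector
equation, with the same eigenvalue, for the kernel `Δf |S ∩ T|` on the `(k - 1)`-subsets of the
remaining `n - 2` points. If all these differences vanish, `v` is constant. Induction on `k` gives the
list of possible eigenvalues (`johnson_eigenvalue`). The choice of `t` makes the eigenvalues for `j = 0`
and `j = 1` equal to the claimed value, and `eigenvalue_gap` shows that those for `j ≥ 2` are strictly
smaller when `3k - 3 ≤ n ≤ k² - k`.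

Strictness for `ϑ'`: since only `j = 0` and `j = 1` are critical, it suffices to decrease these two
eigenvalues to first order. Increasing the entries at disjoint pairs, which `ϑ'` allows and `ϑ` does
not, while increasing `t` in a suitable proportion does so (`schemeEigenvalue_bound`). The minimum
defining `ϑ'` exists by compactness (`exists_isLeast_schrijverValues`).
-/

/-! ### Eigenvalues of the Johnson scheme -/

open Finset in
/-- For a fixed `k`-subset `A` of `X`, exactly `C(k, i) C(m, k - i)` of the `k`-subsets `B` of `X` meet
`A` in `i` points. -/
theorem sum_powersetCard_inter {α : Type*} [DecidableEq α] {k m : ℕ} {X A : Finset α}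
    (hX : #X = k + m) (hA : A ∈ powersetCard k X) (f : ℕ → ℝ) :
    ∑ B ∈ powersetCard k X, f #(A ∩ B) =
      ∑ i ∈ range (k + 1), (k.choose i * m.choose (k - i) : ℝ) * f i := by
  obtain ⟨hAX, hAk⟩ := mem_powersetCard.1 hA
  have hmaps : ∀ B ∈ powersetCard k X, #(A ∩ B) ∈ range (k + 1) := fun B _ => by
    have := card_le_card (inter_subset_left : A ∩ B ⊆ A)
    simp; omega
  rw [← sum_fiberwise_of_maps_to hmaps]
  refine sum_congr rfl fun i hi => ?_
  have hi' : i ≤ k := by simpa [Nat.lt_succ_iff] using hi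
  have hcard : #{B ∈ powersetCard k X | #(A ∩ B) = i} = k.choose i * m.choose (k - i) := by
    have hXA : #(X \ A) = m := by rw [card_sdiff_of_subset hAX]; omega
    rw [← hAk, ← hXA, ← card_powersetCard, hAk, ← card_powersetCard (k - i), ← card_product]
    refine card_nbij' (fun B => (A ∩ B, B \ A)) (fun p => p.1 ∪ p.2) ?_ ?_ ?_ ?_
    · intro B hB
      simp only [coe_filter, mem_powersetCard, Set.mem_ofPred_eq] at hB
      obtain ⟨⟨h1, h2⟩, h3⟩ := hB
      have := card_sdiff_add_card_inter B A
      rw [inter_comm] at this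
      simp only [coe_product, Set.mem_prod, mem_coe, mem_powersetCard]
      exact ⟨⟨inter_subset_left, h3⟩, sdiff_subset_sdiff h1 subset_rfl, by omega⟩
    · rintro ⟨P, Q⟩ h
      simp only [coe_product, Set.mem_prod, mem_coe, mem_powersetCard] at h
      obtain ⟨⟨h1, h2⟩, h3, h4⟩ := h
      have hd : Disjoint A Q := disjoint_of_subset_right h3 disjoint_sdiff
      simp only [coe_filter, mem_powersetCard, Set.mem_ofPred_eq]
      refine ⟨⟨union_subset (h1.trans hAX) (h3.trans sdiff_subset), ?_⟩, ?_⟩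
      · rw [card_union_of_disjoint (disjoint_of_subset_left h1 hd)]; omega
      · rw [inter_union_distrib_left, disjoint_iff_inter_eq_empty.1 hd, union_empty,
          inter_eq_right.2 h1, h2]
    · intro B hB
      ext x
      simp only [mem_union, mem_inter, mem_sdiff]
      tauto
    · rintro ⟨P, Q⟩ h
      simp only [coe_product, Set.mem_prod, mem_coe, mem_powersetCard] at h
      obtain ⟨⟨h1, h2⟩, h3, h4⟩ := h
      have hQ : ∀ x ∈ Q, x ∉ A := fun x hx => (mem_sdiff.1 (h3 hx)).2
      ext x <;> simp only [mem_union, mem_inter, mem_sdiff] <;>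
        have := @h1 x <;> have := hQ x <;> tauto
  rw [sum_congr rfl (g := fun _ => f i) (fun B hB => by rw [(mem_filter.1 hB).2]), sum_const, hcard,
    nsmul_eq_mul]
  push_cast
  rfl

open Finset in
/-- The Johnson graph is connected: a function on the `k`-subsets of `X` that is unchanged when one
element is exchanged for another is constant. -/
theorem eq_of_forall_swap_eq {α β : Type*} [DecidableEq α] {k : ℕ} {X : Finset α}
    {v : Finset α → β}
    (h : ∀ a ∈ X, ∀ b ∈ X, a ≠ b → ∀ S ⊆ (X.erase a).erase b, #S + 1 = k →
      v (insert a S) = v (insert b S)) {A B : Finset α}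
    (hA : A ∈ powersetCard k X) (hB : B ∈ powersetCard k X) : v A = v B := by
  induction hd : #(A \ B) generalizing A with
  | zero =>
    rw [mem_powersetCard] at hA hB
    rw [card_eq_zero, sdiff_eq_empty_iff_subset] at hd
    rw [eq_of_subset_of_card_le hd (by omega)]
  | succ d ih =>
    rw [mem_powersetCard] at hA hB
    obtain ⟨a, ha⟩ : (A \ B).Nonempty := card_pos.1 (by omega)
    have hBA : #(B \ A) = #(A \ B) := card_sdiff_comm (by omega)
    obtain ⟨b, hb⟩ : (B \ A).Nonempty := card_pos.1 (by omega)
    rw [mem_sdiff] at ha hb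
    have hab : a ≠ b := by rintro rfl; exact hb.2 ha.1
    have hbS : b ∉ A.erase a := fun h => hb.2 (mem_of_mem_erase h)
    have hc : #(A.erase a) + 1 = k := by rw [card_erase_add_one ha.1, hA.2]
    have hs := h a (hA.1 ha.1) b (hB.1 hb.1) hab (A.erase a) (fun x hx => by
      rw [mem_erase] at hx
      simp only [mem_erase]
      exact ⟨by rintro rfl; exact hb.2 hx.2, hx.1, hA.1 hx.2⟩) hc
    rw [insert_erase ha.1] at hs
    rw [hs]
    refine ih ?_ ?_
    · rw [mem_powersetCard]
      refine ⟨insert_subset (hB.1 hb.1) ((erase_subset _ _).trans hA.1), ?_⟩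
      rw [card_insert_of_notMem hbS, hc]
    · have : insert b (A.erase a) \ B = (A \ B).erase a := by
        ext x
        simp only [mem_sdiff, mem_insert, mem_erase]
        constructor
        · rintro ⟨rfl | h, h2⟩
          · exact absurd hb.1 h2
          · tauto
        · tauto
      rw [this, card_erase_of_mem (mem_sdiff.2 ha), hd]
      rfl

open Finset in
/-- Passing from `v` to the swap difference `T ↦ v (T ∪ {a}) - v (T ∪ {b})` on subsets avoiding `a` and
`b` turns the kernel `f #(A ∩ B)` into the kernel `Δf #(S ∩ T)`: in the difference of the two rows,
the sets `B` containing both or neither of `a` and `b` cancel. -/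
theorem sum_fwdDiff_inter_mul_swap {α : Type*} [DecidableEq α] {k : ℕ} {Y S : Finset α} {a b : α}
    (hab : a ≠ b) (ha : a ∉ Y) (hb : b ∉ Y) (hS : S ⊆ Y) (f : ℕ → ℝ) (v : Finset α → ℝ) :
    ∑ T ∈ powersetCard k Y, fwdDiff 1 f #(S ∩ T) * (v (insert a T) - v (insert b T)) =
      ∑ B ∈ powersetCard (k + 1) (insert a (insert b Y)), f #(insert a S ∩ B) * v B -
      ∑ B ∈ powersetCard (k + 1) (insert a (insert b Y)), f #(insert b S ∩ B) * v B := by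
  have haS : a ∉ S := fun h => ha (hS h)
  have hbS : b ∉ S := fun h => hb (hS h)
  have haY : a ∉ insert b Y := by simp [hab, ha]
  have key (x : α) (hx : x ∉ Y) (s : ℕ) :
      ∀ T ∈ powersetCard s Y, x ∉ T := fun T hT h => hx ((mem_powersetCard.1 hT).1 h)
  rw [← sum_sub_distrib]
  have split (s : ℕ) (Z : Finset α) (x : α) (hx : x ∉ Z) (g : Finset α → ℝ) :
      ∑ B ∈ powersetCard (s + 1) (insert x Z), g B =
        ∑ B ∈ powersetCard (s + 1) Z, g B + ∑ B ∈ powersetCard s Z, g (insert x B) := by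
    rw [powersetCard_succ_insert hx, sum_union, sum_image]
    · intro B hB C hC h
      have h1 : x ∉ B := fun h => hx ((mem_powersetCard.1 hB).1 h)
      have h2 : x ∉ C := fun h => hx ((mem_powersetCard.1 hC).1 h)
      rw [← erase_insert h1, ← erase_insert h2, h]
    · rw [disjoint_left]
      intro B hB hB'
      obtain ⟨C, -, rfl⟩ := mem_image.1 hB'
      exact hx ((mem_powersetCard.1 hB).1 (mem_insert_self _ _))
  rw [split _ _ _ haY, split _ _ _ hb]
  have h0 : ∑ B ∈ powersetCard (k + 1) Y,
      (f #(insert a S ∩ B) * v B - f #(insert b S ∩ B) * v B) = 0 := by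
    refine sum_eq_zero fun B hB => ?_
    rw [insert_inter_of_notMem (key a ha _ B hB), insert_inter_of_notMem (key b hb _ B hB), sub_self]
  have h1 : ∑ B ∈ powersetCard k (insert b Y), (f #(insert a S ∩ insert a B) * v (insert a B) -
        f #(insert b S ∩ insert a B) * v (insert a B)) =
      ∑ B ∈ powersetCard k Y, (f #(insert a S ∩ insert a B) * v (insert a B) -
        f #(insert b S ∩ insert a B) * v (insert a B)) := by
    symm
    refine sum_subset (powersetCard_mono (subset_insert _ _)) fun B hB hB' => ?_
    rw [mem_powersetCard] at hB hB'
    have hbB : b ∈ B := by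
      by_contra h
      exact hB' ⟨(subset_insert_iff_of_notMem h).1 hB.1, hB.2⟩
    have haB : a ∉ B := fun h => haY (hB.1 h)
    have e1 : insert a S ∩ insert a B = insert a (S ∩ B) := (insert_inter_distrib _ _ _).symm
    have e2 : insert b S ∩ insert a B = insert b (S ∩ B) := by
      ext x
      simp only [mem_inter, mem_insert]
      constructor
      · rintro ⟨rfl | h, rfl | h'⟩ <;> tauto
      · rintro (rfl | h) <;> tauto
    rw [e1, e2, card_insert_of_notMem (by simp [haS]), card_insert_of_notMem (by simp [hbS]),
      sub_self]
  rw [h0, h1, zero_add, ← sum_add_distrib]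
  refine sum_congr rfl fun T hT => ?_
  have haT := key a ha _ T hT
  have hbT := key b hb _ T hT
  have e (x y : α) (hxy : x ≠ y) (hxT : x ∉ T) (hyS : y ∉ S) : insert x S ∩ insert y T = S ∩ T := by
    rw [insert_inter_of_notMem (by simp [hxy, hxT]), inter_insert_of_notMem hyS]
  rw [← insert_inter_distrib, ← insert_inter_distrib, e a b hab haT hbS, e b a hab.symm hbT haS,
    card_insert_of_notMem (fun h => haS (mem_inter.1 h).1),
    card_insert_of_notMem (fun h => hbS (mem_inter.1 h).1), fwdDiff]
  ring

open Finset in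
/-- Every eigenvalue of the kernel `f #(A ∩ B)` on the `k`-subsets of a `(k + m)`-set is one of the
numbers `∑ i, C(k - j, i) C(m - j, k - j - i) Δʲf(i)`. A nonzero eigenvector is either constant, which
gives `j = 0`, or has a nonzero swap difference, which is an eigenvector for `Δf` on the
`(k - 1)`-subsets of a set with two points fewer, with the same eigenvalue. -/
theorem johnson_eigenvalue {α : Type*} [DecidableEq α] {k m : ℕ} {X : Finset α}
    (hX : #X = k + m) {f : ℕ → ℝ} {v : Finset α → ℝ} {μ : ℝ}
    (hv : ∃ A ∈ powersetCard k X, v A ≠ 0)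
    (h : ∀ A ∈ powersetCard k X, ∑ B ∈ powersetCard k X, f #(A ∩ B) * v B = μ * v A) :
    ∃ j ≤ k, j ≤ m ∧ μ = ∑ i ∈ range (k - j + 1),
      ((k - j).choose i * (m - j).choose (k - j - i) : ℝ) * (fwdDiff 1)^[j] f i := by
  induction k generalizing m X f v with
  | zero =>
    obtain ⟨A, hA, hvA⟩ := hv
    have := h A hA
    simp only [powersetCard_zero, mem_singleton] at hA
    subst hA
    refine ⟨0, le_rfl, Nat.zero_le _, ?_⟩
    simpa [hvA, eq_comm] using this
  | succ k ih =>
    by_cases hc : ∀ a ∈ X, ∀ b ∈ X, a ≠ b → ∀ S ⊆ (X.erase a).erase b, #S + 1 = k + 1 →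
      v (insert a S) = v (insert b S)
    · obtain ⟨A, hA, hvA⟩ := hv
      refine ⟨0, Nat.zero_le _, Nat.zero_le _, ?_⟩
      have h1 := h A hA
      rw [sum_congr rfl (g := fun B => f #(A ∩ B) * v A)
        (fun B hB => by rw [eq_of_forall_swap_eq hc hB hA]), ← sum_mul] at h1
      rw [← mul_right_cancel₀ hvA h1, sum_powersetCard_inter hX hA]
      rfl
    · push Not at hc
      obtain ⟨a, ha, b, hb, hab, S, hS, hSk, hne⟩ := hc
      set Y := (X.erase a).erase b with hY
      have haY : a ∉ Y := by simp [hY]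
      have hbY : b ∉ Y := by simp [hY]
      have hbX : b ∈ X.erase a := mem_erase.2 ⟨hab.symm, hb⟩
      have hXY : X = insert a (insert b Y) := by rw [hY, insert_erase hbX, insert_erase ha]
      have hYc : #Y + 2 = #X := by
        rw [hXY, card_insert_of_notMem (by simp [hab, haY]), card_insert_of_notMem hbY]
      have hSY := card_le_card hS
      obtain ⟨m, rfl⟩ : ∃ m', m = m' + 1 := ⟨m - 1, by omega⟩
      obtain ⟨j, hjk, hjm, hμ⟩ := ih (m := m) (X := Y) (f := fwdDiff 1 f)
        (v := fun T => v (insert a T) - v (insert b T)) (by omega)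
        ⟨S, mem_powersetCard.2 ⟨hS, by omega⟩, sub_ne_zero.2 hne⟩ (fun T hT => by
          rw [mem_powersetCard] at hT
          have haT : a ∉ T := fun h => haY (hT.1 h)
          have hbT : b ∉ T := fun h => hbY (hT.1 h)
          have hTX : T ⊆ X := hT.1.trans ((erase_subset _ _).trans (erase_subset _ _))
          rw [sum_fwdDiff_inter_mul_swap hab haY hbY hT.1, ← hXY, h _ (mem_powersetCard.2
            ⟨insert_subset ha hTX, by rw [card_insert_of_notMem haT, hT.2]⟩),
            h _ (mem_powersetCard.2
            ⟨insert_subset hb hTX, by rw [card_insert_of_notMem hbT, hT.2]⟩), mul_sub])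
      refine ⟨j + 1, by omega, by omega, ?_⟩
      rw [hμ, Nat.add_sub_add_right, Nat.add_sub_add_right]
      rfl

/-! ### Largest eigenvalues, attainment and weak duality -/

open Matrix

theorem exists_isLargestEigenvalue {V : Type*} [Fintype V] [DecidableEq V] [Nonempty V]
    {A : Matrix V V ℝ} (hA : A.IsSymm) : ∃ x, IsLargestEigenvalue A x := by
  have hA' : A.IsHermitian := hA
  have h := hA'.spectrum_real_eq_range_eigenvalues
  have hfin : (spectrum ℝ A).Finite := h ▸ Set.finite_range _
  have hne : (spectrum ℝ A).Nonempty := h ▸ Set.range_nonempty _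
  obtain ⟨x, hx, hmax⟩ := Set.exists_max_image _ id hfin hne
  exact ⟨x, hx, fun y hy => hmax y hy⟩

theorem exists_mulVec_eq_of_mem_spectrum {V : Type*} [Fintype V] [DecidableEq V]
    {A : Matrix V V ℝ} {x : ℝ} (hx : x ∈ spectrum ℝ A) : ∃ v ≠ 0, A *ᵥ v = x • v := by
  rw [← Matrix.spectrum_toLin', ← Module.End.hasEigenvalue_iff_mem_spectrum] at hx
  obtain ⟨v, hv⟩ := hx.exists_hasEigenvector
  exact ⟨v, hv.2, by simpa using hv.apply_eq_smul⟩

theorem le_of_forall_dotProduct_mulVec_le {V : Type*} [Fintype V] [DecidableEq V]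
    {A : Matrix V V ℝ} {x y : ℝ} (h : ∀ v, v ⬝ᵥ A *ᵥ v ≤ x * (v ⬝ᵥ v))
    (hy : y ∈ spectrum ℝ A) : y ≤ x := by
  obtain ⟨v, hv, hAv⟩ := exists_mulVec_eq_of_mem_spectrum hy
  have h1 := h v
  rw [hAv, dotProduct_smul, smul_eq_mul] at h1
  have hpos : 0 < v ⬝ᵥ v := by
    simpa using Matrix.dotProduct_star_self_pos_iff.2 hv
  exact le_of_mul_le_mul_right h1 hpos

theorem IsLargestEigenvalue.dotProduct_mulVec_le {V : Type*} [Fintype V] [DecidableEq V]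
    {A : Matrix V V ℝ} {x : ℝ} (hA : A.IsSymm) (hx : IsLargestEigenvalue A x) (v : V → ℝ) :
    v ⬝ᵥ A *ᵥ v ≤ x * (v ⬝ᵥ v) := by
  have hA' : A.IsHermitian := hA
  have hB : (x • (1 : Matrix V V ℝ) - A).IsHermitian := by
    refine Matrix.IsHermitian.sub ?_ hA'
    simp [Matrix.IsHermitian]
  have hpsd : (x • (1 : Matrix V V ℝ) - A).PosSemidef := by
    rw [hB.posSemidef_iff_eigenvalues_nonneg]
    intro i
    have hi := hB.eigenvalues_mem_spectrum_real i
    simp only [Pi.zero_apply]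
    generalize hB.eigenvalues i = z at hi ⊢
    rw [← Algebra.algebraMap_eq_smul_one, ← spectrum.singleton_sub_eq] at hi
    obtain ⟨_, rfl, y, hy, h⟩ := hi
    have := hx.2 hy
    simp only at h
    linarith
  have := hpsd.dotProduct_mulVec_nonneg v
  simp only [star_trivial, sub_mulVec, smul_mulVec, one_mulVec, dotProduct_sub, dotProduct_smul,
    smul_eq_mul] at this
  linarith

/-- The minimum in the definition of `ϑ'` is attained. A feasible `A` with `A ≤ L • 1` has diagonal
entries in `[1, L]`, and the quadratic form at `eᵢ ± eⱼ` then bounds the other entries by `L` as well, so the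
pairs `(A, x)` with `A` feasible and `A ≤ x • 1 ≤ L • 1` form a compact set. -/
theorem exists_isLeast_schrijverValues {V : Type*} [Fintype V] [DecidableEq V] [Nonempty V]
    (G : SimpleGraph V) : ∃ x, IsLeast (schrijverValues G) x := by
  -- The feasible pairs `(A, x)` with `A ≤ x • 1`, the latter expressed through the quadratic form.
  let F : Set (Matrix V V ℝ × ℝ) := {p | p.1.IsSymm ∧ (∀ i j, ¬ G.Adj i j → 1 ≤ p.1 i j) ∧
    ∀ v, v ⬝ᵥ p.1 *ᵥ v ≤ p.2 * (v ⬝ᵥ v)}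
  -- The all-ones matrix is feasible, so only values up to its largest eigenvalue matter.
  obtain ⟨L, hL⟩ := exists_isLargestEigenvalue (A := fun _ _ : V => (1 : ℝ)) rfl
  have hLF : ((fun _ _ : V => (1 : ℝ)), L) ∈ F :=
    ⟨rfl, fun _ _ _ => le_rfl, hL.dotProduct_mulVec_le rfl⟩
  have hdiag : ∀ p ∈ F, ∀ i, p.1 i i ≤ p.2 := fun p hp i => by
    simpa using hp.2.2 (Pi.single i 1)
  have hone : ∀ p ∈ F, ∀ i, 1 ≤ p.1 i i := fun p hp i => hp.2.1 i i (G.loopless.irrefl i)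
  have hoff : ∀ p ∈ F, ∀ i j, |p.1 i j| ≤ p.2 := fun p hp i j => by
    by_cases hij : i = j
    · subst hij
      rw [abs_of_nonneg (by linarith [hone p hp i])]
      exact hdiag p hp i
    have hs : p.1 j i = p.1 i j := hp.1.apply i j
    have e (s : ℝ) : (Pi.single i 1 + Pi.single j s) ⬝ᵥ p.1 *ᵥ (Pi.single i 1 + Pi.single j s) =
        p.1 i i + 2 * s * p.1 i j + s ^ 2 * p.1 j j := by
      simp [mulVec_add, add_dotProduct, dotProduct_add, hs]
      ring
    have e2 (s : ℝ) : (Pi.single i 1 + Pi.single j s : V → ℝ) ⬝ᵥ (Pi.single i 1 + Pi.single j s) =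
        1 + s ^ 2 := by
      simp [dotProduct_add, hij, Ne.symm hij]
      ring
    have h1 := hp.2.2 (Pi.single i 1 + Pi.single j 1)
    have h2 := hp.2.2 (Pi.single i 1 + Pi.single j (-1))
    rw [e, e2] at h1 h2
    have := hone p hp i
    have := hone p hp j
    rw [abs_le]
    constructor <;> linarith
  have hclosed : IsClosed F := by
    have hF : F = {p | p.1ᵀ = p.1} ∩ ({p | ∀ i j, ¬ G.Adj i j → 1 ≤ p.1 i j} ∩
        {p | ∀ v, v ⬝ᵥ p.1 *ᵥ v ≤ p.2 * (v ⬝ᵥ v)}) := rfl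
    rw [hF]
    refine (isClosed_eq (by fun_prop) (by fun_prop)).inter (IsClosed.inter ?_ ?_)
    · simp only [Set.ofPred_forall]
      refine isClosed_iInter fun i => isClosed_iInter fun j => isClosed_iInter fun _ =>
        isClosed_le (by fun_prop) (by fun_prop)
    · simp only [Set.ofPred_forall]
      exact isClosed_iInter fun v => isClosed_le (by fun_prop) (by fun_prop)
  let K : Set (Matrix V V ℝ × ℝ) :=
    (Set.pi Set.univ fun _ => Set.pi Set.univ fun _ => Set.Icc (-L) L) ×ˢ Set.Icc 1 L
  have hK : IsCompact K :=
    (isCompact_univ_pi fun _ => isCompact_univ_pi fun _ => isCompact_Icc).prod isCompact_Icc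
  have hFK : ∀ p ∈ F, p.2 ≤ L → p ∈ K := fun p hp hpL => by
    obtain ⟨i⟩ := ‹Nonempty V›
    refine ⟨fun i _ j _ => ?_, (hone p hp i).trans (hdiag p hp i), hpL⟩
    exact abs_le.1 ((hoff p hp i j).trans hpL)
  obtain ⟨p, hp, hmin⟩ := (hK.inter_left hclosed).exists_isMinOn
    ⟨_, hLF, hFK _ hLF le_rfl⟩ continuous_snd.continuousOn
  have hmin' : ∀ r ∈ F, p.2 ≤ r.2 := fun r hr => by
    by_cases hrL : r.2 ≤ L
    · exact hmin ⟨hr, hFK r hr hrL⟩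
    · exact hp.2.2.2.trans (not_le.1 hrL).le
  obtain ⟨y, hy⟩ := exists_isLargestEigenvalue hp.1.1
  have hyp : y = p.2 := le_antisymm (le_of_forall_dotProduct_mulVec_le hp.1.2.2 hy.1)
    (hmin' (p.1, y) ⟨hp.1.1, hp.1.2.1, hy.dotProduct_mulVec_le hp.1.1⟩)
  refine ⟨y, ⟨p.1, hp.1.1, hp.1.2.1, hy⟩, ?_⟩
  rintro z ⟨A, hA, hA1, hz⟩
  rw [hyp]
  exact hmin' (A, z) ⟨hA, hA1, hz.dotProduct_mulVec_le hA⟩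

/-- Weak duality for `ϑ`: if a Gram matrix `Z` vanishes on the edges, then `⟨J, Z⟩ = ⟨A, Z⟩ ≤ x tr Z`
for every feasible `A` with largest eigenvalue `x`. -/
theorem sum_le_mul_of_mem_lovaszValues {V ι : Type*} [Fintype V] [DecidableEq V] [Fintype ι]
    {G : SimpleGraph V} (u : ι → V → ℝ) (hu : ∀ i j, G.Adj i j → ∑ s, u s i * u s j = 0)
    {x : ℝ} (hx : x ∈ lovaszValues G) :
    ∑ i, ∑ j, ∑ s, u s i * u s j ≤ x * ∑ i, ∑ s, u s i * u s i := by
  obtain ⟨A, hA, hA1, hx⟩ := hx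
  calc ∑ i, ∑ j, ∑ s, u s i * u s j = ∑ i, ∑ j, A i j * ∑ s, u s i * u s j := by
        refine Finset.sum_congr rfl fun i _ => Finset.sum_congr rfl fun j _ => ?_
        by_cases h : G.Adj i j
        · rw [hu i j h, mul_zero]
        · rw [hA1 i j h, one_mul]
    _ = ∑ s, u s ⬝ᵥ A *ᵥ u s := by
        simp only [dotProduct, mulVec, Finset.mul_sum]
        rw [Finset.sum_comm (s := Finset.univ (α := ι))]
        refine Finset.sum_congr rfl fun i _ => ?_
        rw [Finset.sum_comm]
        exact Finset.sum_congr rfl fun s _ => Finset.sum_congr rfl fun j _ => by ring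
    _ ≤ ∑ s, x * (u s ⬝ᵥ u s) := Finset.sum_le_sum fun s _ => hx.dotProduct_mulVec_le hA _
    _ = x * ∑ i, ∑ s, u s i * u s i := by
        rw [← Finset.mul_sum, Finset.sum_comm]
        rfl

/-! ### The eigenvalue inequality -/

theorem sub_mul_choose_pred_mul {k m j : ℕ} (hkm : k ≤ m) (hjk : j ≤ k) :
    ((k : ℝ) - j) * ((m - j).choose (k - j - 1) : ℝ) * ((m : ℝ) - k + 1) =
      ((k : ℝ) - j) ^ 2 * ((m - j).choose (k - j) : ℝ) := by
  rcases hjk.eq_or_lt with rfl | hlt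
  · simp
  obtain ⟨r, rfl⟩ : ∃ r, k = j + r + 1 := ⟨k - j - 1, by omega⟩
  obtain ⟨s, rfl⟩ : ∃ s, m = j + r + 1 + s := ⟨m - (j + r + 1), by omega⟩
  have h := Nat.choose_succ_right_eq (r + 1 + s) r
  rw [show r + 1 + s - r = s + 1 by omega] at h
  have h' : ((r + 1 + s).choose (r + 1) : ℝ) * (r + 1) = (r + 1 + s).choose r * (s + 1) := by
    exact_mod_cast h
  rw [show j + r + 1 + s - j = r + 1 + s by omega,
    show j + r + 1 - j = r + 1 by omega, Nat.add_sub_cancel]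
  push_cast
  linear_combination -(r + 1 : ℝ) * h'

theorem choose_sub_antitone {k m i j : ℕ} (hkm : k ≤ m) (hij : i ≤ j) (hjk : j ≤ k) :
    (m - j).choose (k - j) ≤ (m - i).choose (k - i) := by
  induction j, hij using Nat.le_induction with
  | base => rfl
  | succ j hij ih =>
    refine le_trans ?_ (ih (by omega))
    rw [show m - j = m - (j + 1) + 1 by omega, show k - j = k - (j + 1) + 1 by omega,
      Nat.choose_succ_succ]
    exact Nat.le_add_right _ _

theorem choose_sub_succ_mul {k m j : ℕ} (hkm : k ≤ m) (hjk : j < k) :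
    ((m - (j + 1)).choose (k - (j + 1)) : ℝ) * ((m : ℝ) - j) =
      ((m - j).choose (k - j) : ℝ) * ((k : ℝ) - j) := by
  obtain ⟨r, rfl⟩ : ∃ r, k = j + r + 1 := ⟨k - j - 1, by omega⟩
  obtain ⟨s, rfl⟩ : ∃ s, m = j + r + 1 + s := ⟨m - (j + r + 1), by omega⟩
  have h := Nat.add_one_mul_choose_eq (r + s) r
  have h' : ((r + s + 1 : ℕ) : ℝ) * (r + s).choose r = (r + s + 1).choose (r + 1) * (r + 1 : ℕ) := by
    exact_mod_cast h
  rw [show j + r + 1 + s - (j + 1) = r + s by omega, show j + r + 1 - (j + 1) = r by omega,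
    show j + r + 1 + s - j = r + s + 1 by omega, show j + r + 1 - j = r + 1 by omega]
  push_cast at h' ⊢
  linarith

/-- The least eigenvalue of `G(k + m, k, 1)` off the constants is attained on the second eigenspace only.
With `q = m - k + 1`, the eigenvalue on the `j`-th eigenspace is
`(-1)ʲ C(m - j, k - j) ((k - j)² - j q) / q`, and the statement is that for `j ≥ 2` it exceeds the one
for `j = 1`. -/
theorem eigenvalue_gap {k m j : ℕ} (hk : 3 ≤ k) (hm : 2 * k ≤ m + 3) (hm' : m + 2 * k ≤ k ^ 2)
    (hj : 2 ≤ j) (hjk : j ≤ k) :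
    (-1) ^ j * ((m - j).choose (k - j) : ℝ) * (j * ((m : ℝ) - k + 1) - ((k : ℝ) - j) ^ 2) <
      ((m - 1).choose (k - 1) : ℝ) * (((k : ℝ) - 1) ^ 2 - ((m : ℝ) - k + 1)) := by
  have hkm : k ≤ m := by omega
  have hkR : (3 : ℝ) ≤ k := by exact_mod_cast hk
  have hjR : (2 : ℝ) ≤ j := by exact_mod_cast hj
  have hjkR : (j : ℝ) ≤ k := by exact_mod_cast hjk
  have hm1 : 2 * (k : ℝ) ≤ m + 3 := by exact_mod_cast hm
  have hm2 : (m : ℝ) + 2 * k ≤ k ^ 2 := by exact_mod_cast hm'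
  have hpos : (0 : ℝ) < (m - 1).choose (k - 1) := by
    exact_mod_cast Nat.choose_pos (by omega)
  have hle : ((m - j).choose (k - j) : ℝ) ≤ (m - 1).choose (k - 1) := by
    exact_mod_cast choose_sub_antitone hkm (by omega) hjk
  have hnn : (0 : ℝ) ≤ (m - j).choose (k - j) := Nat.cast_nonneg _
  set b1 : ℝ := (((m - 1).choose (k - 1) : ℕ) : ℝ) with hb1
  set bj : ℝ := (((m - j).choose (k - j) : ℕ) : ℝ) with hbj
  have hrhs : 0 < ((k : ℝ) - 1) ^ 2 - ((m : ℝ) - k + 1) := by nlinarith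
  rcases Nat.even_or_odd j with he | ho
  · rw [he.neg_one_pow, one_mul]
    have h2 : ((m - 2).choose (k - 2) : ℝ) * ((m : ℝ) - 1) = b1 * (k - 1) := by
      have := choose_sub_succ_mul hkm (j := 1) (by omega)
      simpa using this
    -- For `j = 2` the binomials are compared exactly; for even `j ≥ 4` the bounds
    -- `C(m - j, k - j) ≤ C(m - 3, k - 3)` and `j q ≤ k (m - 2)` suffice.
    rcases hj.eq_or_lt with rfl | hj2
    · have hm1' : 0 < (m : ℝ) - 1 := by linarith
      rw [← mul_lt_mul_iff_left₀ hm1']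
      have : bj * ((2 : ℕ) * ((m : ℝ) - k + 1) - ((k : ℝ) - (2 : ℕ)) ^ 2) * ((m : ℝ) - 1) =
        b1 * ((k - 1) * (2 * ((m : ℝ) - k + 1) - ((k : ℝ) - 2) ^ 2)) := by
        push_cast
        linear_combination (2 * ((m : ℝ) - k + 1) - ((k : ℝ) - 2) ^ 2) * h2
      rw [this, mul_assoc]
      refine mul_lt_mul_of_pos_left ?_ hpos
      -- The remaining inequality is concave in `m`, so it follows from the two ends of the range of `m`.
      nlinarith [mul_nonneg (sub_nonneg.2 hm1) (sub_nonneg.2 hm2)]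
    · have hj4 : 4 ≤ j := by
        rcases he with ⟨r, rfl⟩
        omega
      have hk4 : (4 : ℝ) ≤ k := by exact_mod_cast hj4.trans hjk
      have h3 : ((m - 3).choose (k - 3) : ℝ) * ((m : ℝ) - 2) = (m - 2).choose (k - 2) * (k - 2) := by
        have := choose_sub_succ_mul hkm (j := 2) (by omega)
        simpa using this
      have h3j : bj ≤ (m - 3).choose (k - 3) :=
        Nat.cast_le.2 (choose_sub_antitone hkm (by omega) hjk)
      have hm1' : 0 < (m : ℝ) - 1 := by linarith
      have hm2' : 0 < (m : ℝ) - 2 := by linarith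
      set b3 : ℝ := (((m - 3).choose (k - 3) : ℕ) : ℝ)
      have h31 : b3 * ((m : ℝ) - 2) * ((m : ℝ) - 1) = b1 * ((k - 1) * (k - 2)) := by
        rw [h3]; linear_combination (k - 2 : ℝ) * h2
      have hq : 0 ≤ (m : ℝ) - k + 1 := by linarith
      have step1 : bj * (j * ((m : ℝ) - k + 1) - ((k : ℝ) - j) ^ 2) ≤ b3 * (k * ((m : ℝ) - 2)) := by
        calc bj * (j * ((m : ℝ) - k + 1) - ((k : ℝ) - j) ^ 2)
            ≤ bj * (k * ((m : ℝ) - 2)) := by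
              refine mul_le_mul_of_nonneg_left ?_ hnn
              have : (j : ℝ) * ((m : ℝ) - k + 1) ≤ k * ((m : ℝ) - 2) := by
                refine mul_le_mul hjkR ?_ hq (by linarith)
                linarith
              nlinarith [sq_nonneg ((k : ℝ) - j)]
          _ ≤ _ := mul_le_mul_of_nonneg_right h3j (mul_nonneg (by linarith) hm2'.le)
      refine step1.trans_lt ?_
      rw [← mul_lt_mul_iff_left₀ hm1']
      have : b3 * (k * ((m : ℝ) - 2)) * ((m : ℝ) - 1) = b1 * (k * ((k - 1) * (k - 2))) := by
        linear_combination (k : ℝ) * h31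
      rw [this, mul_assoc]
      refine mul_lt_mul_of_pos_left ?_ hpos
      -- The remaining inequality is concave in `m`, so it follows from the two ends of the range of `m`.
      nlinarith [mul_nonneg (sub_nonneg.2 hm1) (sub_nonneg.2 hm2)]
  · rw [ho.neg_one_pow]
    have hj3 : (3 : ℝ) ≤ j := by
      have : 3 ≤ j := by
        rcases ho with ⟨r, rfl⟩
        omega
      exact_mod_cast this
    -- For odd `j` the binomial is at most, and the other factor less than, the one for `j = 1`; that
    -- factor may be negative, which the maximum with `0` takes care of.
    have hlt : ((k : ℝ) - j) ^ 2 - j * ((m : ℝ) - k + 1) <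
        ((k : ℝ) - 1) ^ 2 - ((m : ℝ) - k + 1) := by nlinarith
    calc -1 * bj * (j * ((m : ℝ) - k + 1) - ((k : ℝ) - j) ^ 2)
        = bj * (((k : ℝ) - j) ^ 2 - j * ((m : ℝ) - k + 1)) := by ring
      _ ≤ bj * max 0 (((k : ℝ) - j) ^ 2 - j * ((m : ℝ) - k + 1)) :=
          mul_le_mul_of_nonneg_left (le_max_right _ _) hnn
      _ ≤ b1 * max 0 (((k : ℝ) - j) ^ 2 - j * ((m : ℝ) - k + 1)) :=
          mul_le_mul_of_nonneg_right hle (le_max_left _ _)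
      _ < _ := mul_lt_mul_of_pos_left (max_lt hrhs hlt) hpos

/-! ### Matrices depending on the intersection size -/

/-- The matrix indexed by the `k`-subsets of `Fin n` with entries `f |A ∩ B|`. -/
def intersectionMatrix (n k : ℕ) (f : ℕ → ℝ) :
    Matrix {A : Finset (Fin n) // A.card = k} {A : Finset (Fin n) // A.card = k} ℝ :=
  Matrix.of fun A B => f (A.1 ∩ B.1).card

theorem intersectionMatrix_isSymm (n k : ℕ) (f : ℕ → ℝ) : (intersectionMatrix n k f).IsSymm := by
  ext A B
  simp [intersectionMatrix, Finset.inter_comm]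

theorem sum_powersetCard_univ {n k : ℕ} (g : Finset (Fin n) → ℝ) :
    ∑ B ∈ Finset.powersetCard k Finset.univ, g B =
      ∑ B : {A : Finset (Fin n) // A.card = k}, g B.1 :=
  Finset.sum_subtype _ (fun B => by simp [Finset.mem_powersetCard]) g

theorem eigenvalue_intersectionMatrix {k m : ℕ} {f : ℕ → ℝ} {μ : ℝ}
    (hμ : μ ∈ spectrum ℝ (intersectionMatrix (k + m) k f)) :
    ∃ j ≤ k, j ≤ m ∧ μ = ∑ i ∈ Finset.range (k - j + 1),
      ((k - j).choose i * (m - j).choose (k - j - i) : ℝ) * (fwdDiff 1)^[j] f i := by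
  obtain ⟨v, hv, hMv⟩ := exists_mulVec_eq_of_mem_spectrum hμ
  obtain ⟨A, hA⟩ := Function.ne_iff.1 hv
  refine johnson_eigenvalue (X := (Finset.univ : Finset (Fin (k + m)))) (by simp)
    (v := fun S => if h : S.card = k then v ⟨S, h⟩ else 0) ⟨A.1, ?_, ?_⟩ fun B hB => ?_
  · simp [Finset.mem_powersetCard, A.2]
  · simpa [A.2] using hA
  · have hBk : B.card = k := (Finset.mem_powersetCard.1 hB).2
    have := congrFun hMv ⟨B, hBk⟩
    rw [sum_powersetCard_univ, dif_pos hBk, Finset.sum_congr rfl fun C _ => by rw [dif_pos C.2]]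
    exact this

theorem fwdDiff_iterate_ite {a b : ℝ} (j : ℕ) :
    (fwdDiff 1)^[j] (fun i : ℕ => if i = 0 then a else if i = 1 then b else 0) =
      fun i => if i = 0 then (-1) ^ j * (a - j * b) else if i = 1 then (-1) ^ j * b else 0 := by
  induction j with
  | zero => simp
  | succ j ih =>
    rw [Function.iterate_succ_apply', ih]
    funext i
    rcases i with _ | _ | i
    · simp [fwdDiff]; ring
    · simp [fwdDiff]; ring
    · simp [fwdDiff]

theorem sum_choose_mul_ite {r s : ℕ} (x y : ℝ) :
    ∑ i ∈ Finset.range (r + 1), (r.choose i * s.choose (r - i) : ℝ) *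
      (if i = 0 then x else if i = 1 then y else 0) =
      s.choose r * x + r * s.choose (r - 1) * y := by
  rcases r with _ | r
  · simp
  · rw [Finset.sum_range_succ', Finset.sum_range_succ']
    simp
    ring

theorem sum_choose_mul_choose (k m : ℕ) :
    ∑ i ∈ Finset.range (k + 1), (k.choose i * m.choose (k - i) : ℝ) = (k + m).choose k := by
  rw [Nat.add_choose_eq, Finset.Nat.sum_antidiagonal_eq_sum_range_succ
    (fun i j => k.choose i * m.choose j)]
  push_cast
  rfl

/-- The `j`-th eigenvalue of the matrix with entries `1 + a`, `1 + b`, `1` at pairs of `k`-subsets of a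
`(k + m)`-set meeting in `0`, `1`, and at least `2` points. For `j = k` the truncated `k - j - 1` is
harmless, as its term carries the factor `k - j`. -/
def schemeEigenvalue (k m : ℕ) (a b : ℝ) (j : ℕ) : ℝ :=
  (if j = 0 then ((k + m).choose k : ℝ) else 0) +
    (-1) ^ j * ((a - j * b) * (m - j).choose (k - j) +
      b * (((k : ℝ) - j) * (m - j).choose (k - j - 1)))

/-- The weight with values `1 + a` at `0`, `1 + b` at `1`, and `1` elsewhere. -/
def intersectionWeight (a b : ℝ) (i : ℕ) : ℝ :=
  1 + if i = 0 then a else if i = 1 then b else 0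

theorem eigenvalue_intersectionWeight {k m : ℕ} {a b μ : ℝ}
    (hμ : μ ∈ spectrum ℝ (intersectionMatrix (k + m) k (intersectionWeight a b))) :
    ∃ j ≤ k, μ = schemeEigenvalue k m a b j := by
  obtain ⟨j, hjk, -, rfl⟩ := eigenvalue_intersectionMatrix hμ
  refine ⟨j, hjk, ?_⟩
  have hcast : ((k - j : ℕ) : ℝ) = (k : ℝ) - j := by push_cast [hjk]; rfl
  rcases j with _ | j
  · simp only [Function.iterate_zero, id, intersectionWeight, mul_add, mul_one,
      Finset.sum_add_distrib, sum_choose_mul_ite, Nat.sub_zero, sum_choose_mul_choose,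
      schemeEigenvalue]
    simp
    ring
  · have h1 : fwdDiff 1 (intersectionWeight a b) =
        fwdDiff 1 (fun i : ℕ => if i = 0 then a else if i = 1 then b else 0) := by
      funext i
      simp only [fwdDiff, intersectionWeight]
      ring
    rw [Function.iterate_succ_apply, h1, ← Function.iterate_succ_apply, fwdDiff_iterate_ite,
      sum_choose_mul_ite, schemeEigenvalue, hcast, if_neg (by omega), Nat.succ_eq_add_one]
    ring

/-- The lower bound for `ϑ`. The dual matrix has entries `|A ∩ B| - 1`, which vanish on edges. It is the
Gram matrix of the vectors `χₛ - α 1`, where `χₛ` indicates the sets containing the point `s` and `α`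
is a root of `n α² - 2 k α + 1`, which is real because `n ≤ k²`. -/
theorem le_of_mem_lovaszValues {n k : ℕ} (hk : 1 < k) (hn : 0 < n) (hkn : k ≤ n) (hnk : n ≤ k ^ 2)
    {x : ℝ} (hx : x ∈ lovaszValues (intersectionGraph n k 1)) :
    ((k : ℝ) ^ 2 - n) / (n * (k - 1)) * n.choose k ≤ x := by
  have hnR : (0 : ℝ) < n := by exact_mod_cast hn
  have hkR : (1 : ℝ) < k := by exact_mod_cast hk
  have hnkR : (n : ℝ) ≤ k ^ 2 := by exact_mod_cast hnk
  have hN : (0 : ℝ) < n.choose k := by exact_mod_cast Nat.choose_pos hkn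
  obtain ⟨α, hα⟩ : ∃ α : ℝ, n * α ^ 2 - 2 * k * α + 1 = 0 := by
    refine ⟨(k + √((k : ℝ) ^ 2 - n)) / n, ?_⟩
    have := Real.sq_sqrt (sub_nonneg.2 hnkR)
    field_simp
    linear_combination this
  let χ : Fin n → {A : Finset (Fin n) // A.card = k} → ℝ := fun s A => if s ∈ A.1 then 1 else 0
  have hχ (A) : ∑ s, χ s A = k := by simp [χ, A.2]
  have hχχ (A B) : ∑ s, χ s A * χ s B = ((A.1 ∩ B.1).card : ℝ) := by
    simp only [χ, ← ite_and, mul_ite, mul_one, mul_zero]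
    rw [Finset.sum_boole]
    congr 2
    ext s
    simp [and_comm]
  have hu (A B) : ∑ s, (χ s A - α) * (χ s B - α) = ∑ s, χ s A * χ s B - 1 := by
    simp only [sub_mul, mul_sub, Finset.sum_sub_distrib, ← Finset.sum_mul, ← Finset.mul_sum, hχ]
    simp
    linear_combination hα
  have h := sum_le_mul_of_mem_lovaszValues (fun s A => χ s A - α) (fun A B hAB => by
    rw [hu, hχχ, hAB.2]; simp) hx
  have hcard : Fintype.card {A : Finset (Fin n) // A.card = k} = n.choose k := by simp
  have hdiag : ∑ A, ∑ s, (χ s A - α) * (χ s A - α) = n.choose k * ((k : ℝ) - 1) := by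
    rw [Finset.sum_congr rfl (g := fun _ => (k : ℝ) - 1) fun A _ => by
      rw [hu, hχχ, Finset.inter_self, A.2], Finset.sum_const, Finset.card_univ, hcard, nsmul_eq_mul]
  have hall : ∑ A, ∑ B, ∑ s, (χ s A - α) * (χ s B - α) =
      ∑ s, (∑ A, χ s A) ^ 2 - (n.choose k : ℝ) ^ 2 := by
    simp only [hu, Finset.sum_sub_distrib, Finset.sum_const, Finset.card_univ, hcard]
    rw [nsmul_eq_mul, nsmul_eq_mul, mul_one, sq]
    congr 1
    rw [Finset.sum_congr rfl fun A _ => Finset.sum_comm, Finset.sum_comm]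
    refine Finset.sum_congr rfl fun s _ => ?_
    rw [sq, Finset.sum_mul_sum]
  -- Cauchy–Schwarz for the degrees of the points, whose sum is `k` times the number of sets.
  have hcs : ((n.choose k : ℝ) * k) ^ 2 ≤ n * ∑ s, (∑ A, χ s A) ^ 2 := by
    have := sq_sum_le_card_mul_sum_sq (s := Finset.univ) (f := fun s => ∑ A, χ s A)
    rw [Finset.sum_comm] at this
    simpa only [hχ, Finset.sum_const, Finset.card_univ, hcard, nsmul_eq_mul,
      Fintype.card_fin] using this
  rw [hdiag, hall] at h
  have hk1 : (0 : ℝ) < k - 1 := by linarith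
  rw [div_mul_eq_mul_div, div_le_iff₀ (mul_pos hnR hk1)]
  refine le_of_mul_le_mul_right ?_ hN
  have := mul_le_mul_of_nonneg_left h hnR.le
  linarith

/-! ### The two graph parameters of `G(n, k, 1)` -/

/-- Finitely many affine functions of `δ` that at `δ = 0` lie below `θ`, or reach it with negative slope,
are all below `θ` at some `δ > 0`. -/
theorem exists_pos_forall_add_mul_lt {ι : Type*} (s : Finset ι) (c d : ι → ℝ) (θ : ℝ)
    (h : ∀ j ∈ s, c j < θ ∨ c j = θ ∧ d j < 0) : ∃ δ > 0, ∀ j ∈ s, c j + δ * d j < θ := by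
  have key : ∀ᶠ δ in nhdsWithin (0 : ℝ) (Set.Ioi 0), ∀ j ∈ s, c j + δ * d j < θ := by
    refine (Finset.eventually_all s).2 fun j hj => ?_
    rcases h j hj with h | ⟨h, hd⟩
    · have ht : Filter.Tendsto (fun δ : ℝ => c j + δ * d j) (nhdsWithin 0 (Set.Ioi 0))
          (nhds (c j + 0 * d j)) :=
        (Continuous.tendsto (by fun_prop) 0).mono_left nhdsWithin_le_nhds
      rw [zero_mul, add_zero] at ht
      exact ht.eventually_lt_const h
    · filter_upwards [self_mem_nhdsWithin] with δ hδ
      rw [h]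
      have := mul_neg_of_pos_of_neg hδ hd
      linarith
  obtain ⟨δ, h1, h2⟩ := (key.and self_mem_nhdsWithin).exists
  exact ⟨δ, h2, h1⟩

theorem schemeEigenvalue_add_mul (k m : ℕ) (b a' b' δ : ℝ) (j : ℕ) :
    schemeEigenvalue k m (δ * a') (b + δ * b') j = schemeEigenvalue k m 0 b j +
      δ * ((-1) ^ j * ((a' - j * b') * (m - j).choose (k - j) +
      b' * (((k : ℝ) - j) * (m - j).choose (k - j - 1)))) := by
  simp only [schemeEigenvalue]
  ring

/-- There is a matrix `J + b A₁` all of whose eigenvalues are at most the claimed value of `ϑ`, and a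
direction `a' A₀ + b' A₁` with `a' ≥ 0` (`Aᵢ` indicating the pairs that meet in `i` points) along which
every eigenvalue reaching that value decreases. Equality occurs for `j = 0` and `j = 1` only, by
`eigenvalue_gap`. -/
theorem schemeEigenvalue_bound {k m : ℕ} (hk : 3 ≤ k) (hm : 2 * k ≤ m + 3)
    (hm' : m + 2 * k ≤ k ^ 2) :
    ∃ b a' b' : ℝ, 0 ≤ a' ∧ ∀ j ≤ k,
      schemeEigenvalue k m 0 b j <
        ((k : ℝ) ^ 2 - (k + m : ℕ)) / ((k + m : ℕ) * (k - 1)) * (k + m).choose k ∨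
      schemeEigenvalue k m 0 b j =
        ((k : ℝ) ^ 2 - (k + m : ℕ)) / ((k + m : ℕ) * (k - 1)) * (k + m).choose k ∧
      (-1) ^ j * ((a' - j * b') * (m - j).choose (k - j) +
      b' * (((k : ℝ) - j) * (m - j).choose (k - j - 1))) < 0 := by
  have hkm : k ≤ m := by omega
  have hkR : (3 : ℝ) ≤ k := by exact_mod_cast hk
  have hkmR : (k : ℝ) ≤ m := by exact_mod_cast hkm
  have hm2 : (m : ℝ) + 2 * k ≤ k ^ 2 := by exact_mod_cast hm'
  have hN : (0 : ℝ) < (k + m).choose k := by exact_mod_cast Nat.choose_pos (by omega)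
  have hB : (0 : ℝ) < (m - 1).choose (k - 1) := by exact_mod_cast Nat.choose_pos (by omega)
  have hC : (0 : ℝ) < m.choose k := by exact_mod_cast Nat.choose_pos hkm
  have hq : (0 : ℝ) < (m : ℝ) - k + 1 := by linarith
  have hn : (0 : ℝ) < (k : ℝ) + m := by linarith
  have hk1 : (0 : ℝ) < (k : ℝ) - 1 := by linarith
  have hpred (j : ℕ) (hj : j ≤ k) : ((k : ℝ) - j) * ((m - j).choose (k - j - 1) : ℝ) =
      ((k : ℝ) - j) ^ 2 * ((m - j).choose (k - j) : ℝ) / ((m : ℝ) - k + 1) :=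
    eq_div_of_mul_eq hq.ne' (sub_mul_choose_pred_mul hkm hj)
  have hBC : ((m - 1).choose (k - 1) : ℝ) * m = m.choose k * k := by
    simpa using choose_sub_succ_mul hkm (j := 0) (by omega)
  push_cast
  set N : ℝ := (((k + m).choose k : ℕ) : ℝ)
  set B : ℝ := (((m - 1).choose (k - 1) : ℕ) : ℝ) with hBdef
  set q : ℝ := (m : ℝ) - k + 1 with hqdef
  -- The coefficient for which the eigenvalues for `j = 0` and `j = 1` coincide.
  set t : ℝ := q * N / (B * (k + m) * (k - 1)) with ht
  have ht0 : 0 < t := by positivity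
  have hθ : ((k : ℝ) ^ 2 - (k + m)) / ((k + m) * (k - 1)) * N =
      t / q * (B * (k ^ 2 - (k + m))) := by
    rw [ht]
    field_simp
  -- For the direction `(a', -s)` the eigenvalue for `j = 0` decreases when `a' q < s k²`, and the one for
  -- `j = 1` when `s ((k - 1)² - q) < a' q`; both hold for `a' = (k - 1)²` and `s = q`.
  refine ⟨-t, (k - 1) ^ 2, -q, sq_nonneg _, fun j hj => ?_⟩
  rw [schemeEigenvalue, hpred j hj]
  match j with
  | 0 =>
    right
    simp only [if_true, pow_zero, Nat.cast_zero, Nat.sub_zero, sub_zero, zero_mul, one_mul]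
    constructor
    · have hC' : (m.choose k : ℝ) = B * m / k := by field_simp; linarith
      rw [hC', ht]
      change N + _ = _
      field_simp
      ring
    · have : ((k : ℝ) - 1) ^ 2 * m.choose k + -q * (k ^ 2 * m.choose k / q) =
          (((k : ℝ) - 1) ^ 2 - k ^ 2) * m.choose k := by
        field_simp
        ring
      rw [this]
      exact mul_neg_of_neg_of_pos (by nlinarith) hC
  | 1 =>
    right
    simp only [one_ne_zero, if_false, pow_one, Nat.cast_one, ← hBdef]
    constructor
    · rw [hθ]
      field_simp
      rw [hqdef]
      ring
    · have : -1 * ((((k : ℝ) - 1) ^ 2 - 1 * -q) * B + -q * ((k - 1) ^ 2 * B / q)) = -(q * B) := by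
        field_simp
        ring
      rw [this]
      exact neg_neg_of_pos (mul_pos hq hB)
  | j + 2 =>
    left
    have hgap := eigenvalue_gap hk hm hm' (j := j + 2) (by omega) hj
    rw [hθ, if_neg (by omega)]
    have h2 := mul_lt_mul_of_pos_left hgap (div_pos ht0 hq)
    refine lt_of_eq_of_lt ?_ (h2.trans_eq ?_)
    · rw [← hqdef]
      field_simp
      ring
    · rw [← hBdef]
      ring

theorem intersectionMatrix_intersectionWeight_apply {n k : ℕ} (hk : 2 ≤ k) (a b : ℝ)
    {A B : {A : Finset (Fin n) // A.card = k}} (h : ¬ (intersectionGraph n k 1).Adj A B) :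
    intersectionMatrix n k (intersectionWeight a b) A B =
      1 + if (A.1 ∩ B.1).card = 0 then a else 0 := by
  have h1 : (A.1 ∩ B.1).card ≠ 1 := fun h1 => h ⟨by
    rintro rfl
    rw [Finset.inter_self, A.2] at h1
    omega, h1⟩
  simp [intersectionMatrix, intersectionWeight, h1]

theorem intersectionGraph_isLeast_and_lt {n k : ℕ} (hk : 3 ≤ k) (hn : 3 * k - 3 ≤ n)
    (hn' : n < k ^ 2 - k + 1) :
    IsLeast (lovaszValues (intersectionGraph n k 1))
        (((k : ℝ) ^ 2 - n) / (n * (k - 1)) * n.choose k) ∧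
      ∃ x ∈ schrijverValues (intersectionGraph n k 1),
        x < ((k : ℝ) ^ 2 - n) / (n * (k - 1)) * n.choose k := by
  have hkk : k * 3 ≤ k ^ 2 := by rw [sq]; exact Nat.mul_le_mul_left k hk
  obtain ⟨m, rfl⟩ : ∃ m, n = k + m := ⟨n - k, by omega⟩
  obtain ⟨b, a', b', ha', hbd⟩ := schemeEigenvalue_bound hk (m := m) (by omega) (by omega)
  have : Nonempty {A : Finset (Fin (k + m)) // A.card = k} := by
    rw [← Fintype.card_pos_iff]
    simpa using Nat.choose_pos (Nat.le_add_right k m)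
  constructor
  · have hlow : ∀ x ∈ lovaszValues (intersectionGraph (k + m) k 1), _ ≤ x := fun x hx =>
      le_of_mem_lovaszValues (by omega) (by omega) (by omega) (by omega) hx
    refine ⟨?_, hlow⟩
    obtain ⟨x, hx⟩ := exists_isLargestEigenvalue
      (intersectionMatrix_isSymm (k + m) k (intersectionWeight 0 b))
    have hmem : x ∈ lovaszValues (intersectionGraph (k + m) k 1) :=
      ⟨_, intersectionMatrix_isSymm _ _ _, fun A B h => by
        rw [intersectionMatrix_intersectionWeight_apply (by omega) _ _ h]; simp, hx⟩
    obtain ⟨j, hjk, hj⟩ := eigenvalue_intersectionWeight hx.1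
    have hle : x ≤ _ := hj.trans_le ((hbd j hjk).elim le_of_lt fun h => h.1.le)
    rwa [le_antisymm hle (hlow x hmem)] at hmem
  · obtain ⟨δ, hδ, hlt⟩ := exists_pos_forall_add_mul_lt (Finset.range (k + 1)) _ _ _
      fun j hj => hbd j (by simpa [Nat.lt_succ_iff] using hj)
    obtain ⟨x, hx⟩ := exists_isLargestEigenvalue
      (intersectionMatrix_isSymm (k + m) k (intersectionWeight (δ * a') (b + δ * b')))
    refine ⟨x, ⟨_, intersectionMatrix_isSymm _ _ _, fun A B h => ?_, hx⟩, ?_⟩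
    · rw [intersectionMatrix_intersectionWeight_apply (by omega) _ _ h]
      have := mul_nonneg hδ.le ha'
      split_ifs <;> linarith
    · obtain ⟨j, hjk, rfl⟩ := eigenvalue_intersectionWeight hx.1
      rw [schemeEigenvalue_add_mul]
      exact hlt j (by simpa [Nat.lt_succ_iff] using hjk)

theorem choose_sub_two_lt {n k : ℕ} (hk : 2 ≤ k) (hkn : k < n) (hn' : n < k ^ 2 - k + 1) :
    ((n - 2).choose (k - 2) : ℝ) < ((k : ℝ) ^ 2 - n) / (n * (k - 1)) * n.choose k := by
  have hkR : (2 : ℝ) ≤ k := by exact_mod_cast hk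
  have hknR : (k : ℝ) < n := by exact_mod_cast hkn
  have hkk : k ≤ k ^ 2 := by nlinarith
  have hnR : (n : ℝ) < k ^ 2 - k + 1 := by
    have : n + k < k ^ 2 + 1 := by omega
    have : (n : ℝ) + k < k ^ 2 + 1 := by exact_mod_cast this
    linarith
  have h0 : ((n - 1).choose (k - 1) : ℝ) * n = n.choose k * k := by
    simpa using choose_sub_succ_mul hkn.le (j := 0) (by omega)
  have h1 : ((n - 2).choose (k - 2) : ℝ) * (n - 1) = (n - 1).choose (k - 1) * (k - 1) := by
    simpa using choose_sub_succ_mul hkn.le (j := 1) (by omega)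
  have hpos : (0 : ℝ) < n.choose k := by exact_mod_cast Nat.choose_pos hkn.le
  have hn0 : (0 : ℝ) < n := by linarith
  have hn1 : (0 : ℝ) < (n : ℝ) - 1 := by linarith
  have hk1 : (0 : ℝ) < (k : ℝ) - 1 := by linarith
  have e : ((n - 2).choose (k - 2) : ℝ) = (k * (k - 1)) / (n * (n - 1)) * n.choose k := by
    field_simp
    linear_combination (n : ℝ) * h1 + ((k : ℝ) - 1) * h0
  rw [e]
  refine mul_lt_mul_of_pos_right ?_ hpos
  rw [div_lt_div_iff₀ (by positivity) (by positivity)]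
  -- After clearing denominators, the difference of the two sides is `n` times this product.
  have : 0 < ((n : ℝ) - k) * (k ^ 2 - k + 1 - n) := mul_pos (by linarith) (by linarith)
  nlinarith [mul_pos hn0 this]

theorem mainTheorem3 :
    (∀ n k : ℕ, 3 ≤ k → 3 * k - 3 ≤ n → n < k ^ 2 - k + 1 →
      -- the infima defining the two graph parameters are minima
      IsLeast (lovaszValues (intersectionGraph n k 1)) (lovaszNumber (intersectionGraph n k 1)) ∧
      IsLeast (schrijverValues (intersectionGraph n k 1))
        (schrijverNumber (intersectionGraph n k 1)) ∧
      lovaszNumber (intersectionGraph n k 1) > ((n - 2).choose (k - 2) : ℝ) ∧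
      lovaszNumber (intersectionGraph n k 1) =
        ((k : ℝ) ^ 2 - (n : ℝ)) / ((n : ℝ) * ((k : ℝ) - 1)) * (n.choose k : ℝ) ∧
      schrijverNumber (intersectionGraph n k 1) < lovaszNumber (intersectionGraph n k 1)) ∧
    -- the family is infinite, also up to isomorphism: its members have arbitrarily many vertices
    (∀ N : ℕ, ∃ n k : ℕ, 3 ≤ k ∧ 3 * k - 3 ≤ n ∧ n < k ^ 2 - k + 1 ∧
      N < Fintype.card {A : Finset (Fin n) // A.card = k} ∧
      schrijverNumber (intersectionGraph n k 1) < lovaszNumber (intersectionGraph n k 1)) := by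
  have main : ∀ n k : ℕ, 3 ≤ k → 3 * k - 3 ≤ n → n < k ^ 2 - k + 1 →
      IsLeast (lovaszValues (intersectionGraph n k 1)) (lovaszNumber (intersectionGraph n k 1)) ∧
      IsLeast (schrijverValues (intersectionGraph n k 1))
        (schrijverNumber (intersectionGraph n k 1)) ∧
      lovaszNumber (intersectionGraph n k 1) > ((n - 2).choose (k - 2) : ℝ) ∧
      lovaszNumber (intersectionGraph n k 1) =
        ((k : ℝ) ^ 2 - (n : ℝ)) / ((n : ℝ) * ((k : ℝ) - 1)) * (n.choose k : ℝ) ∧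
      schrijverNumber (intersectionGraph n k 1) < lovaszNumber (intersectionGraph n k 1) := by
    intro n k hk hn hn'
    obtain ⟨hL, y, hy, hlt⟩ := intersectionGraph_isLeast_and_lt hk hn hn'
    have hLe : lovaszNumber (intersectionGraph n k 1) = _ := hL.csInf_eq
    have : Nonempty {A : Finset (Fin n) // A.card = k} := by
      rw [← Fintype.card_pos_iff]
      simpa using Nat.choose_pos (by omega)
    obtain ⟨x, hS⟩ := exists_isLeast_schrijverValues (intersectionGraph n k 1)
    have hSe : schrijverNumber (intersectionGraph n k 1) = x := hS.csInf_eq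
    rw [hLe, hSe]
    exact ⟨hL, hS, choose_sub_two_lt (by omega) (by omega) hn', rfl, (hS.2 hy).trans_lt hlt⟩
  refine ⟨main, fun N => ?_⟩
  have h1 : 3 * (N + 3) - 3 < (N + 3) ^ 2 - (N + 3) + 1 := by
    rw [show (N + 3) ^ 2 = N * N + 6 * N + 9 by ring]
    omega
  refine ⟨3 * (N + 3) - 3, N + 3, by omega, le_rfl, h1, ?_,
    (main _ _ (by omega) le_rfl h1).2.2.2.2⟩
  have h2 : (N + 3 + 1).choose (N + 3) ≤ (3 * (N + 3) - 3).choose (N + 3) :=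
    Nat.choose_le_choose _ (by omega)
  rw [Nat.choose_succ_self_right] at h2
  simp only [Fintype.card_finset_len, Fintype.card_fin]
  omega
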